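/- Let $H=(V,E,w)$ be a finite connected weighted hypergraph ($E$ a set of nonempty subsets of the finite set $V$, $w\colon E\to\mathbb R_{>0}$), and write $x\sim y$ if some $e\in E$ contains both $x$ and $y$. Let $d(x,y)$ be the least $n$ for which there are $x=z_0\sim z_1\sim\dots\sim z_n=y$, let $d_x=\sum_{e\ni x}w_e$ (positive for every $x$ if $|V|\ge2$, by connectedness; assume $d_x>0$ if $V=\{x\}$) and $D=\mathrm{diag}(d_x)$. Call $f\in\mathbb R^V$ weighted $1$-Lipschitz if $|f(x)/d_x-f(y)/d_y|\le d(x,y)$ for all $x,y\in V$. For $e\in E$ let $B_e\subset\mathbb R^V$ be the convex hull of $\{\delta_x-\delta_y : x,y\in e\}$, and define the multivalued Laplacians $$L(f)=\Big\{\sum_{e\in E}w_e\,\mathtt b_e(\mathtt b_e^{\top}f) \;:\; \mathtt b_e\in\operatorname{argmax}_{\mathtt b\in B_e}\mathtt b^{\top}f\Big\},\qquad \mathcal L(f)=L(D^{-1}f).$$ For $\lambda>0$ let $J_\lambda=(I+\lambda\mathcal L)^{-1}$, and for $x\ne y$ put $$\mathsf{KD}_\lambda(x,y)=\sup\Big\{\frac{J_\lambda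 f(x)}{d_x}-\frac{J_\lambda f(y)}{d_y} : f \text{ weighted } 1\text{-Lipschitz}\Big\},\quad \kappa_\lambda(x,y)=1-\frac{\mathsf{KD}_\lambda(x,y)}{d(x,y)},\quad \overline\kappa(x,y)=\limsup_{\lambda\downarrow0}\frac{\kappa_\lambda(x,y)}{\lambda}.$$ Let $\overline\kappa_0=\inf_{x\neq y}\overline\kappa(x,y)$ (if $|V|\le 1$, $\overline\kappa_0$ may be given any real value). **Theorem.** For every $f\in\mathbb R^V$ there is a unique $u\colon[0,\infty)\to\mathbb R^V$, absolutely continuous on bounded intervals, with $u(0)=f$ and $u'(t)\in-\mathcal L(u(t))$ for almost every $t>0$; write $h_tf=e^{-t\mathcal L}f:=u(t)$ for the heat semigroup so defined. For every weighted $1$-Lipschitz $f$, all $x,y\in V$ and all $t>0$, $$\frac{h_tf(x)}{d_x}-\frac{h_tf(y)}{d_y}\le e^{-\overline\kappa_0 t}\,d(x,y).$$ -/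

import Mathlib

open scoped Topology

/-- A finite weighted undirected hypergraph with vertex set `V`: a set of nonempty subsets of `V`
(the hyperedges) with positive weights. Only the values of `weight` on hyperedges matter. -/
structure WeightedHypergraph (V : Type*) [Fintype V] where
  edges : Finset (Finset V)
  edges_nonempty : ∀ e ∈ edges, e.Nonempty
  weight : Finset V → ℝ
  weight_pos : ∀ e ∈ edges, 0 < weight e

namespace WeightedHypergraph

noncomputable section

variable {V : Type*} [Fintype V] [DecidableEq V] (H : WeightedHypergraph V)

/-- `x ∼ y`: some hyperedge contains both `x` and `y`. -/
def Adj (x y : V) : Prop := ∃ e ∈ H.edges, x ∈ e ∧ y ∈ e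

/-- There is a sequence `z 0 = x, …, z n = y` of successively adjacent vertices. -/
def HasPath (x y : V) (n : ℕ) : Prop :=
  ∃ z : ℕ → V, z 0 = x ∧ z n = y ∧ ∀ i < n, H.Adj (z i) (z (i + 1))

def Connected : Prop := ∀ x y : V, ∃ n : ℕ, H.HasPath x y n

/-- The distance `d(x, y)`: the least length of a path from `x` to `y`. -/
def dist (x y : V) : ℕ := sInf {n : ℕ | H.HasPath x y n}

/-- The degree `d_x`, the sum of the weights of the hyperedges containing `x`. -/
def deg (x : V) : ℝ := ∑ e ∈ H.edges with x ∈ e, H.weight e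

/-- `D⁻¹ f`, where `D` is the diagonal matrix of the degrees. -/
def normalize (f : V → ℝ) : V → ℝ := fun x => f x / H.deg x

/-- The base polytope `B_e`, the convex hull of the vectors `δ_x - δ_y` with `x, y ∈ e`. -/
def basePolytope (e : Finset V) : Set (V → ℝ) :=
  convexHull ℝ {b | ∃ x ∈ e, ∃ y ∈ e, b = Pi.single x 1 - Pi.single y 1}

/-- The (multivalued) submodular hypergraph Laplacian
`L f = {∑ₑ wₑ bₑ (bₑᵀ f) | bₑ ∈ argmax_{b ∈ Bₑ} bᵀ f}`. -/
def laplacian (f : V → ℝ) : Set (V → ℝ) :=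
  {g | ∃ b : Finset V → V → ℝ,
    (∀ e ∈ H.edges, b e ∈ basePolytope e ∧ ∀ b' ∈ basePolytope e, b' ⬝ᵥ f ≤ b e ⬝ᵥ f) ∧
    g = ∑ e ∈ H.edges, (H.weight e * (b e ⬝ᵥ f)) • b e}

/-- The normalized Laplacian `ℒ f = L (D⁻¹ f)`. -/
def normLaplacian (f : V → ℝ) : Set (V → ℝ) := H.laplacian (H.normalize f)

/-- The resolvent `J_λ f = (I + λ ℒ)⁻¹ f`, as a multivalued operator: the set of all `g` with
`f ∈ g + λ ℒ g`. -/
def resolvent (lam : ℝ) (f : V → ℝ) : Set (V → ℝ) :=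
  {g | ∃ g' ∈ H.normLaplacian g, f = g + lam • g'}

/-- Weighted `K`-Lipschitz functions. -/
def WeightedLipschitz (K : ℝ) (f : V → ℝ) : Prop :=
  ∀ x y : V, |f x / H.deg x - f y / H.deg y| ≤ K * H.dist x y

/-- The `λ`-nonlinear Kantorovich difference: the supremum of
`⟨J_λ f, δ_x⟩ - ⟨J_λ f, δ_y⟩` over weighted `1`-Lipschitz `f`, for the inner product
`⟨f, g⟩ = ∑ₓ f x * g x / d_x`, so that `⟨g, δ_x⟩ = g x / d_x`. -/
def kantorovichDiff (lam : ℝ) (x y : V) : ℝ :=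
  sSup {r | ∃ f, H.WeightedLipschitz 1 f ∧ ∃ g ∈ H.resolvent lam f,
    r = g x / H.deg x - g y / H.deg y}

/-- The `λ`-coarse Ricci curvature (of interest for `x ≠ y`). -/
def lamCurvature (lam : ℝ) (x y : V) : ℝ := 1 - H.kantorovichDiff lam x y / H.dist x y

/-- The upper coarse Ricci curvature `limsup_{λ ↓ 0} κ_λ(x, y) / λ`. -/
def upperCurvature (x y : V) : ℝ :=
  Filter.limsup (fun lam : ℝ => H.lamCurvature lam x y / lam) (𝓝[>] 0)

/-- The infimum of the upper coarse Ricci curvature over all pairs of distinct vertices. -/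
def infUpperCurvature : ℝ := ⨅ p : {p : V × V // p.1 ≠ p.2}, H.upperCurvature p.1.1 p.1.2

/-- `u` is a strong solution on `[0, ∞)` of the heat equation `u' ∈ -ℒ u`, `u 0 = f`: it is
absolutely continuous on bounded intervals and satisfies the inclusion at almost every time. -/
def IsHeatSolution (f : V → ℝ) (u : ℝ → V → ℝ) : Prop :=
  u 0 = f ∧
  (∀ T : ℝ, 0 < T → AbsolutelyContinuousOnInterval u 0 T) ∧
  ∀ᵐ t : ℝ, 0 < t → ∃ v, HasDerivAt u v t ∧ -v ∈ H.normLaplacian (u t)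

/-- The heat semigroup `h_t = e^{-tℒ}`: `t ↦ h_t f` is the strong solution of the heat equation
with initial value `f`. -/
def heat (t : ℝ) (f : V → ℝ) : V → ℝ := Classical.epsilon (H.IsHeatSolution f) t

end

end WeightedHypergraph

section Evolution

open MeasureTheory Filter Set
open scoped NNReal Topology RealInnerProductSpace

theorem LipschitzWith.comp_absolutelyContinuousOnInterval {X Y : Type*} [PseudoMetricSpace X]
    [PseudoMetricSpace Y] {g : X → Y} {K : ℝ≥0} (hg : LipschitzWith K g) {f : ℝ → X} {a b : ℝ}
    (hf : AbsolutelyContinuousOnInterval f a b) :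
    AbsolutelyContinuousOnInterval (fun t => g (f t)) a b := by
  unfold AbsolutelyContinuousOnInterval at hf ⊢
  refine squeeze_zero (fun t => Finset.sum_nonneg fun i _ => dist_nonneg) (fun t => ?_)
    (by simpa using hf.const_mul (K : ℝ))
  rw [Finset.mul_sum]
  exact Finset.sum_le_sum fun i _ => hg.dist_le_mul _ _

theorem AbsolutelyContinuousOnInterval.le_of_ae_deriv_nonpos {F : ℝ → ℝ} {T : ℝ} (hT : 0 ≤ T)
    (hF : AbsolutelyContinuousOnInterval F 0 T)
    (h : ∀ᵐ t : ℝ, 0 < t → ∃ v, HasDerivAt F v t ∧ v ≤ 0) : F T ≤ F 0 := by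
  have h1 := hF.integral_deriv_eq_sub
  have h2 : ∫ t in (0 : ℝ)..T, deriv F t ≤ ∫ _ in (0 : ℝ)..T, (0 : ℝ) := by
    rw [intervalIntegral.integral_of_le hT, intervalIntegral.integral_of_le hT]
    refine setIntegral_mono_ae_restrict ?_ ?_ ?_
    · exact (intervalIntegrable_iff_integrableOn_Ioc_of_le hT).1 hF.intervalIntegrable_deriv
    · exact integrableOn_zero
    · refine (ae_restrict_iff' measurableSet_Ioc).2 ?_
      filter_upwards [h] with t ht hmem
      obtain ⟨v, hv, hv0⟩ := ht hmem.1
      simpa [hv.deriv] using hv0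
  simp only [intervalIntegral.integral_zero] at h2
  linarith

/-- The operator `A` is monotone. -/
def IsMonotoneOperator {E : Type*} [NormedAddCommGroup E] [InnerProductSpace ℝ E]
    (A : E → Set E) : Prop :=
  ∀ x y, ∀ a ∈ A x, ∀ b ∈ A y, 0 ≤ ⟪a - b, x - y⟫

/-- `I + lam A` is surjective for every `lam > 0`. -/
def HasResolvents {E : Type*} [AddCommGroup E] [Module ℝ E] (A : E → Set E) : Prop :=
  ∀ lam : ℝ, 0 < lam → ∀ f, ∃ g, ∃ a ∈ A g, f = g + lam • a

namespace IsMonotoneOperator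

variable {E : Type*} [NormedAddCommGroup E] [InnerProductSpace ℝ E] {A : E → Set E}

theorem resolvent_nonexpansive (hA : IsMonotoneOperator A) {lam : ℝ} (hl : 0 ≤ lam)
    {f f' g g' a a' : E} (ha : a ∈ A g) (ha' : a' ∈ A g') (hf : f = g + lam • a)
    (hf' : f' = g' + lam • a') : ‖g - g'‖ ≤ ‖f - f'‖ := by
  have h := hA g g' a ha a' ha'
  have e : f - f' = (g - g') + lam • (a - a') := by
    rw [hf, hf', smul_sub]; abel
  have h1 : ‖g - g'‖ * ‖g - g'‖ ≤ ‖f - f'‖ * ‖g - g'‖ := by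
    calc ‖g - g'‖ * ‖g - g'‖ = ⟪g - g', g - g'⟫ := (real_inner_self_eq_norm_mul_norm _).symm
      _ ≤ ⟪f - f', g - g'⟫ := by
        rw [e, inner_add_left, real_inner_smul_left]
        nlinarith [mul_nonneg hl h]
      _ ≤ _ := real_inner_le_norm _ _
  rcases (norm_nonneg (g - g')).eq_or_lt with h0 | h0
  · rw [← h0]; exact norm_nonneg _
  · exact le_of_mul_le_mul_right h1 h0

theorem eq_of_ae_hasDerivAt (hA : IsMonotoneOperator A) {u v : ℝ → E} {T : ℝ} (hT : 0 ≤ T)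
    (h0 : u 0 = v 0)
    (huc : AbsolutelyContinuousOnInterval u 0 T) (hvc : AbsolutelyContinuousOnInterval v 0 T)
    (hu : ∀ᵐ t : ℝ, 0 < t → ∃ w, HasDerivAt u w t ∧ -w ∈ A (u t))
    (hv : ∀ᵐ t : ℝ, 0 < t → ∃ w, HasDerivAt v w t ∧ -w ∈ A (v t)) : u T = v T := by
  have hn : AbsolutelyContinuousOnInterval (fun t => ‖(u - v) t‖) 0 T :=
    lipschitzWith_one_norm.comp_absolutelyContinuousOnInterval (huc.sub hvc)
  have hsq : AbsolutelyContinuousOnInterval (fun t => ‖u t - v t‖ ^ 2) 0 T := by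
    convert hn.mul hn using 1
    ext t; simp [sq]
  have := hsq.le_of_ae_deriv_nonpos hT (by
    filter_upwards [hu, hv] with t h1 h2 ht
    obtain ⟨w, hw, hwA⟩ := h1 ht
    obtain ⟨z, hz, hzA⟩ := h2 ht
    refine ⟨_, (hw.sub hz).norm_sq, ?_⟩
    have := hA _ _ _ hwA _ hzA
    rw [show -w - -z = -(w - z) by abel, inner_neg_left, real_inner_comm] at this
    simp only [Pi.sub_apply]
    linarith)
  simp only [h0, sub_self, norm_zero] at this
  have h3 : ‖u T - v T‖ ^ 2 = 0 := le_antisymm (by simpa using this) (by positivity)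
  exact sub_eq_zero.1 (norm_eq_zero.1 (by simpa using h3))

section Euler

variable {J : E → E} {h C : ℝ}

theorem norm_resolvent_le (hA : IsMonotoneOperator A) (hh : 0 ≤ h)
    (h0 : (0 : E) ∈ A 0) {f g a : E} (ha : a ∈ A g) (hf : f = g + h • a) : ‖g‖ ≤ ‖f‖ := by
  simpa using hA.resolvent_nonexpansive hh ha h0 hf (by simp : (0 : E) = 0 + h • (0 : E))

theorem norm_iterate_le (hA : IsMonotoneOperator A) (h0 : (0 : E) ∈ A 0) (hh : 0 ≤ h)
    (hJ : ∀ f, ∃ a ∈ A (J f), f = J f + h • a) (f : E) (k : ℕ) : ‖J^[k] f‖ ≤ ‖f‖ := by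
  induction k with
  | zero => simp
  | succ k ih =>
    rw [Function.iterate_succ_apply']
    obtain ⟨a, ha, he⟩ := hJ (J^[k] f)
    exact (hA.norm_resolvent_le hh h0 ha he).trans ih

theorem norm_iterate_sub_le (hA : IsMonotoneOperator A) (h0 : (0 : E) ∈ A 0) (hh : 0 ≤ h)
    (hC : 0 ≤ C) (hbd : ∀ x, ∀ a ∈ A x, ‖a‖ ≤ C * ‖x‖)
    (hJ : ∀ f, ∃ a ∈ A (J f), f = J f + h • a) (f : E) (k j : ℕ) :
    ‖J^[k + j] f - J^[k] f‖ ≤ j * h * (C * ‖f‖) := by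
  induction j with
  | zero => simp
  | succ j ih =>
    rw [← add_assoc, Function.iterate_succ_apply']
    obtain ⟨a, ha, he⟩ := hJ (J^[k + j] f)
    have h1 : ‖J (J^[k + j] f) - J^[k + j] f‖ ≤ h * (C * ‖f‖) := by
      have h2 : ‖J (J^[k + j] f)‖ ≤ ‖f‖ := by
        have := hA.norm_iterate_le h0 hh hJ f (k + j + 1)
        rwa [Function.iterate_succ_apply'] at this
      rw [norm_sub_rev]
      nth_rewrite 1 [he]
      rw [add_sub_cancel_left, norm_smul, Real.norm_of_nonneg hh]
      exact mul_le_mul_of_nonneg_left ((hbd _ a ha).trans (by gcongr)) hh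
    calc _ ≤ ‖J (J^[k + j] f) - J^[k + j] f‖ + ‖J^[k + j] f - J^[k] f‖ :=
          norm_sub_le_norm_sub_add_norm_sub _ _ _
      _ ≤ h * (C * ‖f‖) + j * h * (C * ‖f‖) := add_le_add h1 ih
      _ = _ := by push_cast; ring

theorem iterate_evi (hA : IsMonotoneOperator A) (h0 : (0 : E) ∈ A 0) (hh : 0 ≤ h)
    (hC : 0 ≤ C) (hbd : ∀ x, ∀ a ∈ A x, ‖a‖ ≤ C * ‖x‖)
    (hJ : ∀ f, ∃ a ∈ A (J f), f = J f + h • a) (f : E) {v b : E} (hb : b ∈ A v) (k j : ℕ) :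
    ‖J^[k + j] f - v‖ ^ 2 - ‖J^[k] f - v‖ ^ 2 ≤
      2 * (-(j * h) * ⟪b, J^[k] f - v⟫ + ‖b‖ * (C * ‖f‖) * (j * h) ^ 2) := by
  induction j with
  | zero => simp
  | succ j ih =>
    have hM := hA.norm_iterate_sub_le h0 hh hC hbd hJ f k (j + 1)
    rw [← add_assoc, Function.iterate_succ_apply'] at hM ⊢
    obtain ⟨a, ha, he⟩ := hJ (J^[k + j] f)
    set y := J^[k + j] f
    set g := J y
    set x := J^[k] f
    have h1 : ‖g - v‖ ^ 2 - ‖y - v‖ ^ 2 ≤ 2 * (-h * ⟪a, g - v⟫) := by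
      have : y - v = (g - v) + h • a := by rw [he]; abel
      rw [this, norm_add_sq_real, real_inner_smul_right, real_inner_comm]
      nlinarith [sq_nonneg ‖h • a‖]
    have h2 : ⟪b, g - v⟫ ≤ ⟪a, g - v⟫ := by
      have := hA g v a ha b hb
      rw [inner_sub_left] at this; linarith
    have h3 : ⟪b, x - v⟫ - ‖b‖ * ((j + 1 : ℕ) * h * (C * ‖f‖)) ≤ ⟪b, g - v⟫ := by
      have h4 : ⟪b, g - v⟫ = ⟪b, x - v⟫ + ⟪b, g - x⟫ := by
        rw [← inner_add_right]; congr 1; abel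
      have h5 := neg_le_of_abs_le (abs_real_inner_le_norm b (g - x))
      have h6 := mul_le_mul_of_nonneg_left hM (norm_nonneg b)
      linarith
    have h7 := mul_le_mul_of_nonneg_left (h3.trans h2) hh
    have h8 : 0 ≤ ‖b‖ * (C * ‖f‖) * h ^ 2 * j := by positivity
    push_cast at h7 ⊢
    nlinarith

end Euler

theorem mem_of_forall_inner_nonneg (hR : HasResolvents A) {x a : E}
    (h : ∀ y, ∀ b ∈ A y, 0 ≤ ⟪a - b, x - y⟫) : a ∈ A x := by
  obtain ⟨y, b, hb, he⟩ := hR 1 one_pos (x + a)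
  have h1 := h y b hb
  have h2 : a - b = -(x - y) := by
    rw [one_smul] at he
    have : a = y + b - x := by rw [← he]; abel
    rw [this]; abel
  rw [h2, inner_neg_left, real_inner_self_eq_norm_sq] at h1
  have h3 : x - y = 0 := by
    rw [← norm_eq_zero]
    exact pow_eq_zero_iff (two_ne_zero) |>.1 (le_antisymm (by linarith) (by positivity))
  rw [h3, neg_zero] at h2
  rwa [sub_eq_zero.1 h2, sub_eq_zero.1 h3]

theorem exists_lipschitz_evolution [FiniteDimensional ℝ E] (hA : IsMonotoneOperator A)
    (hR : HasResolvents A) (h0 : (0 : E) ∈ A 0) {C : ℝ} (hC : 0 ≤ C)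
    (hbd : ∀ x, ∀ a ∈ A x, ‖a‖ ≤ C * ‖x‖) (f : E) :
    ∃ (u : ℝ → E) (M : ℝ≥0), u 0 = f ∧ LipschitzWith M u ∧
      ∀ᵐ t : ℝ, 0 < t → ∃ v, HasDerivAt u v t ∧ -v ∈ A (u t) := by
  have hpos : ∀ n : ℕ, (0 : ℝ) < 1 / (n + 1 : ℝ) := fun n => by positivity
  choose J hJ using fun n : ℕ => hR (1 / (n + 1 : ℝ)) (hpos n)
  set U : ℕ → ℝ → E := fun n t => (J n)^[⌊t * (n + 1 : ℝ)⌋₊] f with hU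
  set 𝒰 : Ultrafilter ℕ := hyperfilter ℕ
  have hlim : ∀ t, ∃ x, Tendsto (fun n => U n t) 𝒰 (𝓝 x) := fun t => by
    obtain ⟨x, -, hx⟩ := (isCompact_closedBall (0 : E) ‖f‖).ultrafilter_le_nhds
      (𝒰.map fun n => U n t) (by
        rw [Ultrafilter.coe_map, le_principal_iff]
        refine Filter.mem_map.2 (Eventually.of_forall fun n => ?_)
        simpa using hA.norm_iterate_le h0 (hpos n).le (hJ n) f _)
    exact ⟨x, hx⟩
  choose u hu using hlim
  have hfl : ∀ t : ℝ, 0 ≤ t →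
      Tendsto (fun n : ℕ => (⌊t * (n + 1 : ℝ)⌋₊ : ℝ) * (1 / (n + 1 : ℝ))) 𝒰 (𝓝 t) := fun t ht => by
    have h1 : Tendsto (fun n : ℕ => (n + 1 : ℝ)) atTop atTop :=
      tendsto_natCast_atTop_atTop.atTop_add tendsto_const_nhds
    have := ((tendsto_nat_floor_mul_div_atTop ht).comp h1).mono_left Nat.hyperfilter_le_atTop
    simpa [Function.comp_def, div_eq_mul_inv] using this
  have hsplit : ∀ s t : ℝ, 0 ≤ s → s ≤ t → ∀ n : ℕ, ∃ j : ℕ,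
      ⌊t * (n + 1 : ℝ)⌋₊ = ⌊s * (n + 1 : ℝ)⌋₊ + j ∧
      (j : ℝ) * (1 / (n + 1 : ℝ)) = (⌊t * (n + 1 : ℝ)⌋₊ : ℝ) * (1 / (n + 1 : ℝ)) -
        (⌊s * (n + 1 : ℝ)⌋₊ : ℝ) * (1 / (n + 1 : ℝ)) := fun s t hs hst n => by
    have : ⌊s * (n + 1 : ℝ)⌋₊ ≤ ⌊t * (n + 1 : ℝ)⌋₊ := Nat.floor_mono (by gcongr)
    obtain ⟨j, hj⟩ := Nat.exists_eq_add_of_le this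
    exact ⟨j, hj, by rw [hj]; push_cast; ring⟩
  have hLip : ∀ s t : ℝ, 0 ≤ s → s ≤ t → ‖u t - u s‖ ≤ (C * ‖f‖) * (t - s) := fun s t hs hst => by
    have h1 := ((hu t).sub (hu s)).norm
    have h2 := (((hfl t (hs.trans hst)).sub (hfl s hs)).mul_const (C * ‖f‖))
    rw [mul_comm]
    refine le_of_tendsto_of_tendsto h1 h2 (Eventually.of_forall fun n => ?_)
    obtain ⟨j, hj, hj'⟩ := hsplit s t hs hst n
    simp only [← hj', hU]
    rw [hj]
    exact hA.norm_iterate_sub_le h0 (hpos n).le hC hbd (hJ n) f _ j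
  have hEvi : ∀ s t : ℝ, 0 ≤ s → s ≤ t → ∀ v, ∀ b ∈ A v, ‖u t - v‖ ^ 2 - ‖u s - v‖ ^ 2 ≤
      2 * (-(t - s) * ⟪b, u s - v⟫ + ‖b‖ * (C * ‖f‖) * (t - s) ^ 2) := fun s t hs hst v b hb => by
    have hd := (hfl t (hs.trans hst)).sub (hfl s hs)
    have h1 := (((hu t).sub_const v).norm.pow 2).sub (((hu s).sub_const v).norm.pow 2)
    have h2 := ((hd.neg.mul (tendsto_const_nhds.inner (𝕜 := ℝ) (f := fun _ => b)
      ((hu s).sub_const v))).add ((hd.pow 2).const_mul (‖b‖ * (C * ‖f‖)))).const_mul 2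
    refine le_of_tendsto_of_tendsto h1 h2 (Eventually.of_forall fun n => ?_)
    obtain ⟨j, hj, hj'⟩ := hsplit s t hs hst n
    simp only [← hj', hU]
    rw [hj]
    exact hA.iterate_evi h0 (hpos n).le hC hbd (hJ n) f hb _ j
  have hu0 : u 0 = f := by
    refine tendsto_nhds_unique (hu 0) ?_
    simp [hU]
  have hM : 0 ≤ C * ‖f‖ := by positivity
  have hL : LipschitzWith ⟨C * ‖f‖, hM⟩ fun t => u (max t 0) := by
    refine LipschitzWith.of_dist_le_mul fun s t => ?_
    have key : ∀ s t : ℝ, s ≤ t →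
        dist (u (max s 0)) (u (max t 0)) ≤ (C * ‖f‖) * dist s t := fun s t hst => by
      rw [dist_comm, dist_eq_norm]
      refine (hLip _ _ (le_max_right _ _) (max_le_max_right 0 hst)).trans ?_
      refine mul_le_mul_of_nonneg_left ?_ hM
      rw [Real.dist_eq, abs_sub_comm]
      exact (le_abs_self _).trans (abs_max_sub_max_le_abs t s 0)
    rcases le_total s t with h | h
    · exact key s t h
    · rw [dist_comm, dist_comm s t]; exact key t s h
  refine ⟨fun t => u (max t 0), ⟨C * ‖f‖, hM⟩, by simpa using hu0, hL, ?_⟩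
  filter_upwards [hL.ae_differentiableAt_real] with t ht htpos
  refine ⟨_, ht.hasDerivAt, ?_⟩
  rw [max_eq_left htpos.le]
  refine mem_of_forall_inner_nonneg hR fun y b hb => ?_
  have h1 := ((ht.hasDerivAt.sub_const y).norm_sq.tendsto_slope).mono_left
    (nhdsWithin_mono t (show Ioi t ⊆ {t}ᶜ from fun s hs => ne_of_gt (mem_Ioi.1 hs)))
  have h2 : Tendsto (fun s : ℝ => 2 * (-⟪b, u t - y⟫ + ‖b‖ * (C * ‖f‖) * (s - t))) (𝓝[>] t)
      (𝓝 (2 * (-⟪b, u t - y⟫ + ‖b‖ * (C * ‖f‖) * (t - t)))) :=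
    (Continuous.tendsto (by fun_prop) t).mono_left nhdsWithin_le_nhds
  have h3 := le_of_tendsto_of_tendsto h1 h2 (by
    filter_upwards [self_mem_nhdsWithin] with s hs
    have hs : t < s := hs
    rw [slope_def_field, div_le_iff₀ (sub_pos.2 hs), max_eq_left htpos.le,
      max_eq_left (htpos.trans hs).le]
    have := hEvi t s htpos.le hs.le y b hb
    nlinarith)
  rw [max_eq_left htpos.le] at h3
  rw [inner_sub_left, inner_neg_left, real_inner_comm]
  linarith

end IsMonotoneOperator

end Evolution

section NonnegativeLeastSquares

theorem nonneg_of_forall_pos_quadratic {G Q : ℝ} (hQ : 0 ≤ Q) {r : ℝ} (hr : 0 < r)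
    (h : ∀ t : ℝ, 0 < t → t ≤ r → 0 ≤ 2 * t * G + t ^ 2 * Q) : 0 ≤ G := by
  by_contra! hG
  have ht : 0 < min r (-G / (Q + 1)) := lt_min hr (div_pos (by linarith) (by linarith))
  have h1 := h _ ht (min_le_left _ _)
  set t := min r (-G / (Q + 1))
  have h2 : t * (Q + 1) ≤ -G := by
    rw [← le_div_iff₀ (by linarith)]; exact min_le_right _ _
  nlinarith

/-- Existence of a solution of a weighted nonnegative least squares problem, together with its
Karush-Kuhn-Tucker conditions. -/
theorem exists_nonneg_least_squares {ι κ : Type*} [Fintype ι] [Fintype κ] [DecidableEq ι]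
    (c : κ → ℝ) (hc : ∀ k, 0 < c k) (l : κ → ι → ℝ) (r : κ → ℝ)
    (hl : ∀ i, ∃ k, ∀ θ : ι → ℝ, 0 ≤ θ → θ i ≤ ∑ j, l k j * θ j) :
    ∃ θ : ι → ℝ, 0 ≤ θ ∧ ∀ i, 0 ≤ ∑ k, c k * l k i * (∑ j, l k j * θ j - r k) ∧
      (0 < θ i → ∑ k, c k * l k i * (∑ j, l k j * θ j - r k) = 0) := by
  set Ψ : (ι → ℝ) → ℝ := fun θ => ∑ k, c k * (∑ j, l k j * θ j - r k) ^ 2 with hΨ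
  have hcont : Continuous Ψ := by fun_prop
  choose k hk using hl
  set R : ι → ℝ := fun i => 1 + Ψ 0 / c (k i) + |r (k i)|
  have hterm : ∀ θ k, c k * (∑ j, l k j * θ j - r k) ^ 2 ≤ Ψ θ := fun θ k =>
    Finset.single_le_sum (f := fun k => c k * (∑ j, l k j * θ j - r k) ^ 2)
      (fun k _ => mul_nonneg (hc k).le (sq_nonneg _)) (Finset.mem_univ k)
  have hbound : ∀ θ : ι → ℝ, 0 ≤ θ → Ψ θ ≤ Ψ 0 → θ ≤ R := fun θ hθ hle i => by
    have h1 := hk i θ hθ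
    have h2 := (hterm θ (k i)).trans hle
    rw [mul_comm, ← le_div_iff₀ (hc _)] at h2
    have h3 := le_abs_self (r (k i))
    simp only [R]
    nlinarith [sq_nonneg (∑ j, l (k i) j * θ j - r (k i) - 1)]
  have hΨ0 : 0 ≤ Ψ 0 := Finset.sum_nonneg fun k _ => mul_nonneg (hc k).le (sq_nonneg _)
  have hR0 : (0 : ι → ℝ) ≤ R := hbound 0 le_rfl le_rfl
  obtain ⟨θ, hθm, hθ⟩ := (isCompact_Icc (a := (0 : ι → ℝ)) (b := R)).exists_isMinOn
    ⟨0, le_rfl, hR0⟩ hcont.continuousOn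
  have hmin : ∀ η : ι → ℝ, 0 ≤ η → Ψ θ ≤ Ψ η := fun η hη => by
    by_cases h : η ≤ R
    · exact hθ ⟨hη, h⟩
    · exact (hθ ⟨le_rfl, hR0⟩).trans (le_of_lt (not_le.1 fun h' => h (hbound η hη h')))
  refine ⟨θ, hθm.1, fun i => ?_⟩
  set G := ∑ k, c k * l k i * (∑ j, l k j * θ j - r k)
  set Q := ∑ k, c k * l k i ^ 2
  have hQ : 0 ≤ Q := Finset.sum_nonneg fun k _ => mul_nonneg (hc k).le (sq_nonneg _)
  have hvar : ∀ t : ℝ, -θ i ≤ t → 0 ≤ 2 * t * G + t ^ 2 * Q := fun t ht => by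
    have h1 := hmin (θ + Pi.single i t) (fun j => by
      by_cases h : j = i
      · subst h; simp; linarith
      · simpa [h] using hθm.1 j)
    have h2 : Ψ (θ + Pi.single i t) = Ψ θ + (2 * t * G + t ^ 2 * Q) := by
      simp only [hΨ, G, Q, Finset.mul_sum, ← Finset.sum_add_distrib]
      refine Finset.sum_congr rfl fun k _ => ?_
      have : ∑ j, l k j * (θ + Pi.single i t : ι → ℝ) j = ∑ j, l k j * θ j + l k i * t := by
        simp [mul_add, Finset.sum_add_distrib, Pi.single_apply]
      rw [this]; ring
    linarith
  have hG : 0 ≤ G := nonneg_of_forall_pos_quadratic hQ one_pos fun t ht _ =>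
    hvar t (by have : 0 ≤ θ i := hθm.1 i
               linarith)
  refine ⟨hG, fun hi => le_antisymm ?_ hG⟩
  have := nonneg_of_forall_pos_quadratic (G := -G) hQ hi fun t _ ht' => by
    have := hvar (-t) (by linarith)
    linarith
  linarith

end NonnegativeLeastSquares

namespace WeightedHypergraph

section Laplacian

theorem zero_mem_basePolytope {V : Type*} [DecidableEq V] {e : Finset V} (he : e.Nonempty) :
    (0 : V → ℝ) ∈ basePolytope e := by
  obtain ⟨x, hx⟩ := he
  exact subset_convexHull _ _ ⟨x, hx, x, hx, (sub_self _).symm⟩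

variable {V : Type*} [Fintype V] [DecidableEq V]

theorem dotProduct_le_of_mem_basePolytope {e : Finset V} {p : V → ℝ} {c : ℝ}
    (h : ∀ x ∈ e, ∀ y ∈ e, p x - p y ≤ c) {b : V → ℝ} (hb : b ∈ basePolytope e) :
    b ⬝ᵥ p ≤ c := by
  refine convexHull_min (t := {b : V → ℝ | b ⬝ᵥ p ≤ c}) ?_ ?_ hb
  · rintro b ⟨x, hx, y, hy, rfl⟩
    simpa [sub_dotProduct] using h x hx y hy
  · exact convex_halfSpace_le (f := fun b : V → ℝ => b ⬝ᵥ p)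
      ⟨fun _ _ => add_dotProduct _ _ _, fun _ _ => smul_dotProduct _ _ _⟩ c

theorem apply_eq_zero_of_mem_basePolytope {e : Finset V} {b : V → ℝ} (hb : b ∈ basePolytope e)
    {z : V} (hz : z ∉ e) : b z = 0 := by
  have key : ∀ s : ℝ, b ⬝ᵥ Pi.single z s ≤ 0 := fun s =>
    dotProduct_le_of_mem_basePolytope (fun x hx y hy => by
      rw [Pi.single_apply, Pi.single_apply, if_neg (by rintro rfl; exact hz hx),
        if_neg (by rintro rfl; exact hz hy), sub_zero]) hb
  have h1 := key 1
  have h2 := key (-1)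
  simp at h1 h2
  linarith

theorem abs_apply_le_one_of_mem_basePolytope {e : Finset V} {b : V → ℝ}
    (hb : b ∈ basePolytope e) (z : V) : |b z| ≤ 1 := by
  have key : ∀ s : ℝ, |s| = 1 → b ⬝ᵥ Pi.single z s ≤ 1 := fun s hs =>
    dotProduct_le_of_mem_basePolytope (fun x _ y _ => by
      have h1 := le_abs_self s
      have h2 := neg_abs_le s
      rw [Pi.single_apply, Pi.single_apply]
      split_ifs <;> linarith) hb
  have h1 := key 1 (by simp)
  have h2 := key (-1) (by simp)
  simp at h1 h2
  exact abs_le.2 ⟨by linarith, h1⟩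

variable (H : WeightedHypergraph V)

theorem laplacian_monotone {p p' a a' : V → ℝ} (ha : a ∈ H.laplacian p)
    (ha' : a' ∈ H.laplacian p') : 0 ≤ (a - a') ⬝ᵥ (p - p') := by
  obtain ⟨b, hb, rfl⟩ := ha
  obtain ⟨b', hb', rfl⟩ := ha'
  rw [← Finset.sum_sub_distrib, sum_dotProduct]
  refine Finset.sum_nonneg fun e he => ?_
  simp only [sub_dotProduct, smul_dotProduct, dotProduct_sub, smul_eq_mul]
  have hw := (H.weight_pos e he).le
  have h0 := zero_mem_basePolytope (H.edges_nonempty e he)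
  have h1 : 0 ≤ b e ⬝ᵥ p := by simpa using (hb e he).2 0 h0
  have h2 : 0 ≤ b' e ⬝ᵥ p' := by simpa using (hb' e he).2 0 h0
  have h3 := (hb e he).2 _ (hb' e he).1
  have h4 := (hb' e he).2 _ (hb e he).1
  set m := b e ⬝ᵥ p
  set m' := b' e ⬝ᵥ p'
  have h5 : m * (b e ⬝ᵥ p') ≤ m * m' := mul_le_mul_of_nonneg_left h4 h1
  have h6 : m' * (b' e ⬝ᵥ p) ≤ m' * m := mul_le_mul_of_nonneg_left h3 h2
  have h7 : 0 ≤ m * m - m * (b e ⬝ᵥ p') - (m' * (b' e ⬝ᵥ p) - m' * m') := by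
    nlinarith [sq_nonneg (m - m')]
  linarith [mul_nonneg hw h7]

theorem zero_mem_laplacian_zero : (0 : V → ℝ) ∈ H.laplacian 0 :=
  ⟨0, fun e he => ⟨zero_mem_basePolytope (H.edges_nonempty e he), by simp⟩, by simp⟩

theorem smul_mem_laplacian {p a : V → ℝ} (ha : a ∈ H.laplacian p) {c : ℝ} (hc : 0 ≤ c) :
    c • a ∈ H.laplacian (c • p) := by
  obtain ⟨b, hb, rfl⟩ := ha
  refine ⟨b, fun e he => ⟨(hb e he).1, fun b' hb' => ?_⟩, ?_⟩
  · simp only [dotProduct_smul, smul_eq_mul]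
    exact mul_le_mul_of_nonneg_left ((hb e he).2 b' hb') hc
  · rw [Finset.smul_sum]
    refine Finset.sum_congr rfl fun e _ => ?_
    rw [smul_smul, dotProduct_smul, smul_eq_mul]
    congr 1; ring

theorem laplacian_congr {p p' : V → ℝ} (h : ∀ e ∈ H.edges, ∀ x ∈ e, p x = p' x) :
    H.laplacian p = H.laplacian p' := by
  have key : ∀ e ∈ H.edges, ∀ b ∈ basePolytope e, b ⬝ᵥ p = b ⬝ᵥ p' := fun e he b hb =>
    Finset.sum_congr rfl fun x _ => by
      by_cases hx : x ∈ e
      · rw [h e he x hx]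
      · rw [apply_eq_zero_of_mem_basePolytope hb hx, zero_mul, zero_mul]
  suffices ∀ p p' : V → ℝ, (∀ e ∈ H.edges, ∀ b ∈ basePolytope e, b ⬝ᵥ p = b ⬝ᵥ p') →
      H.laplacian p ⊆ H.laplacian p' from
    (this p p' key).antisymm (this p' p fun e he b hb => (key e he b hb).symm)
  rintro p p' key _ ⟨b, hb, rfl⟩
  refine ⟨b, fun e he => ⟨(hb e he).1, fun b' hb' => ?_⟩, Finset.sum_congr rfl fun e he => ?_⟩
  · rw [← key e he _ hb', ← key e he _ (hb e he).1]
    exact (hb e he).2 b' hb'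
  · rw [key e he _ (hb e he).1]

theorem abs_laplacian_apply_le {p a : V → ℝ} (ha : a ∈ H.laplacian p) (z : V) :
    |a z| ≤ (∑ e ∈ H.edges, H.weight e) * (2 * ‖p‖) := by
  obtain ⟨b, hb, rfl⟩ := ha
  rw [Finset.sum_apply, Finset.sum_mul]
  refine (Finset.abs_sum_le_sum_abs _ _).trans (Finset.sum_le_sum fun e he => ?_)
  have h1 : 0 ≤ b e ⬝ᵥ p := by
    simpa using (hb e he).2 0 (zero_mem_basePolytope (H.edges_nonempty e he))
  have h2 : b e ⬝ᵥ p ≤ 2 * ‖p‖ := dotProduct_le_of_mem_basePolytope (fun x _ y _ => by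
    have hx := abs_le.1 (norm_le_pi_norm p x)
    have hy := abs_le.1 (norm_le_pi_norm p y)
    linarith [hx.2, hy.1]) (hb e he).1
  have hw := (H.weight_pos e he).le
  rw [Pi.smul_apply, smul_eq_mul, abs_mul, abs_of_nonneg (mul_nonneg hw h1)]
  calc _ ≤ H.weight e * (b e ⬝ᵥ p) * 1 := mul_le_mul_of_nonneg_left
        (abs_apply_le_one_of_mem_basePolytope (hb e he).1 z) (mul_nonneg hw h1)
    _ ≤ _ := by rw [mul_one]; exact mul_le_mul_of_nonneg_left h2 hw

theorem exists_resolvent_laplacian {d : V → ℝ} (hd : ∀ x, 0 < d x) {lam : ℝ} (hl : 0 < lam)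
    (f : V → ℝ) : ∃ p, ∃ a ∈ H.laplacian p, f = d * p + lam • a := by
  classical
  let ι := {i : Finset V × V × V // i.1 ∈ H.edges ∧ i.2.1 ∈ i.1 ∧ i.2.2 ∈ i.1}
  let col : ι → V → ℝ := fun i => Pi.single i.1.2.1 1 - Pi.single i.1.2.2 1
  let l : V ⊕ H.edges → ι → ℝ :=
    Sum.elim (fun z i => lam * H.weight i.1.1 * col i z) (fun e i => if i.1.1 = e then 1 else 0)
  obtain ⟨θ, hθ0, hθ⟩ := exists_nonneg_least_squares
    (Sum.elim (fun z => 1 / d z) (fun e : H.edges => lam * H.weight e)) (by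
      rintro (z | e)
      · exact one_div_pos.2 (hd z)
      · exact mul_pos hl (H.weight_pos e e.2)) l (Sum.elim f 0) (by
      intro i
      refine ⟨Sum.inr ⟨i.1.1, i.2.1⟩, fun θ hθ => ?_⟩
      have := Finset.single_le_sum (f := fun j => l (Sum.inr ⟨i.1.1, i.2.1⟩) j * θ j)
        (fun j _ => mul_nonneg (by simp only [l, Sum.elim_inr]; split_ifs <;> simp) (hθ j))
        (Finset.mem_univ i)
      simpa [l] using this)
  set s : Finset V → ℝ := fun e => ∑ i with i.1.1 = e, θ i with hs
  set q : V → ℝ := ∑ i, (H.weight i.1.1 * θ i) • col i with hq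
  set p : V → ℝ := fun z => (f z - lam * q z) / d z with hp
  have hgrad : ∀ i : ι, ∑ k, Sum.elim (fun z => 1 / d z) (fun e : H.edges => lam * H.weight e) k *
      l k i * (∑ j, l k j * θ j - (Sum.elim f 0 : V ⊕ H.edges → ℝ) k) =
      lam * H.weight i.1.1 * (s i.1.1 - (p i.1.2.1 - p i.1.2.2)) := fun i => by
    have h1 : ∀ z, ∑ j, l (Sum.inl z) j * θ j = lam * q z := fun z => by
      simp only [l, hq, Sum.elim_inl, Finset.sum_apply, Pi.smul_apply, smul_eq_mul, Finset.mul_sum]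
      exact Finset.sum_congr rfl fun j _ => by ring
    have h2 : ∀ e : H.edges, ∑ j, l (Sum.inr e) j * θ j = s e := fun e => by
      simp [l, hs, Finset.sum_filter]
    rw [Fintype.sum_sum_type]
    simp only [h1, h2, Sum.elim_inl, Sum.elim_inr]
    have h3 : ∑ z, 1 / d z * l (Sum.inl z) i * (lam * q z - f z) =
        -(lam * H.weight i.1.1 * (p i.1.2.1 - p i.1.2.2)) := by
      have : col i ⬝ᵥ p = p i.1.2.1 - p i.1.2.2 := by simp [col, sub_dotProduct]
      rw [← this, dotProduct, Finset.mul_sum, ← Finset.sum_neg_distrib]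
      refine Finset.sum_congr rfl fun z _ => ?_
      simp only [l, Sum.elim_inl, hp]
      ring
    have h4 : ∑ e : H.edges, lam * H.weight e * l (Sum.inr e) i * (s e - (0 : H.edges → ℝ) e) =
        lam * H.weight i.1.1 * s i.1.1 := by
      rw [Finset.sum_eq_single ⟨i.1.1, i.2.1⟩]
      · simp [l]
      · intro e _ he
        have : ¬ i.1.1 = (e : Finset V) := fun h => he (Subtype.ext h.symm)
        simp [l, this]
      · simp
    rw [h3, h4]; ring
  have hs0 : ∀ e, 0 ≤ s e := fun e => Finset.sum_nonneg fun i _ => hθ0 i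
  have hle : ∀ e ∈ H.edges, ∀ x ∈ e, ∀ y ∈ e, p x - p y ≤ s e := fun e he x hx y hy => by
    have := (hθ ⟨(e, x, y), he, hx, hy⟩).1
    rw [hgrad] at this
    have := nonneg_of_mul_nonneg_right this (mul_pos hl (H.weight_pos e he))
    simp only at this
    linarith
  have heq : ∀ i : ι, θ i * (col i ⬝ᵥ p) = θ i * s i.1.1 := fun i => by
    rcases (hθ0 i).eq_or_lt with h | h
    · simp only [Pi.zero_apply] at h
      rw [← h]; simp
    · have := (hθ i).2 h
      rw [hgrad] at this
      have := (mul_eq_zero.1 this).resolve_left (mul_pos hl (H.weight_pos _ i.2.1)).ne'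
      have h' : col i ⬝ᵥ p = p i.1.2.1 - p i.1.2.2 := by simp [col, sub_dotProduct]
      rw [h']; congr 1; linarith
  set b : Finset V → V → ℝ := fun e => ∑ i with i.1.1 = e, (θ i / s e) • col i with hb
  have hbp : ∀ e, b e ⬝ᵥ p = s e := fun e => by
    simp only [hb, sum_dotProduct, smul_dotProduct, smul_eq_mul]
    rcases eq_or_ne (s e) 0 with h | h
    · simp [h]
    · have : ∀ i ∈ Finset.univ.filter (fun i : ι => i.1.1 = e), θ i / s e * (col i ⬝ᵥ p) = θ i :=
        fun i hi => by
          have hi : i.1.1 = e := (Finset.mem_filter.1 hi).2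
          rw [div_mul_eq_mul_div, heq, hi, mul_div_assoc, div_self h, mul_one]
      rw [Finset.sum_congr rfl this]
  have hbmem : ∀ e ∈ H.edges, b e ∈ basePolytope e := fun e he => by
    rcases eq_or_ne (s e) 0 with h | h
    · have : b e = 0 := by simp [hb, h]
      rw [this]; exact zero_mem_basePolytope (H.edges_nonempty e he)
    · refine (convex_convexHull ℝ _).sum_mem (fun i _ => div_nonneg (hθ0 i) (hs0 e)) ?_ ?_
      · rw [← Finset.sum_div]; exact div_self h
      · intro i hi
        have hi : i.1.1 = e := (Finset.mem_filter.1 hi).2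
        exact subset_convexHull _ _ ⟨i.1.2.1, hi ▸ i.2.2.1, i.1.2.2, hi ▸ i.2.2.2, rfl⟩
  refine ⟨p, q, ⟨b, fun e he => ⟨hbmem e he, fun b' hb' => ?_⟩, ?_⟩, ?_⟩
  · rw [hbp]; exact dotProduct_le_of_mem_basePolytope (hle e he) hb'
  · have : ∀ e ∈ H.edges, (H.weight e * (b e ⬝ᵥ p)) • b e =
        ∑ i with i.1.1 = e, (H.weight i.1.1 * θ i) • col i := fun e _ => by
      rw [hbp]
      simp only [hb]
      rw [Finset.smul_sum]
      refine Finset.sum_congr rfl fun i hi => ?_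
      have hi' : i.1.1 = e := (Finset.mem_filter.1 hi).2
      rw [smul_smul, hi']
      congr 1
      rcases eq_or_ne (s e) 0 with h | h
      · have : θ i = 0 := (Finset.sum_eq_zero_iff_of_nonneg fun i _ => hθ0 i).1 h i hi
        simp [this]
      · field_simp
    rw [Finset.sum_congr rfl this, hq]
    exact (Finset.sum_fiberwise_of_maps_to (fun i _ => i.2.1) _).symm
  · ext z
    simp only [Pi.add_apply, Pi.mul_apply, Pi.smul_apply, smul_eq_mul, hp]
    have := (hd z).ne'
    field_simp
    ring

end Laplacian

end WeightedHypergraph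

section Gronwall

open MeasureTheory Filter
open scoped NNReal

theorem AbsolutelyContinuousOnInterval.le_exp_mul_of_ae_deriv_le {F : ℝ → ℝ} {T K : ℝ}
    (hT : 0 ≤ T) (hF : AbsolutelyContinuousOnInterval F 0 T)
    (h : ∀ᵐ t : ℝ, 0 < t → ∃ v, HasDerivAt F v t ∧ v ≤ -K * F t) :
    F T ≤ Real.exp (-K * T) * F 0 := by
  have hexp : AbsolutelyContinuousOnInterval (fun t => Real.exp (K * t)) 0 T :=
    ContDiffOn.absolutelyContinuousOnInterval
      (Real.contDiff_exp.comp (contDiff_const.mul contDiff_id)).contDiffOn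
  have h1 := (hexp.mul hF).le_of_ae_deriv_nonpos hT (by
    filter_upwards [h] with t ht hpos
    obtain ⟨v, hv, hle⟩ := ht hpos
    refine ⟨_, (((hasDerivAt_id t).const_mul K).exp).mul hv, ?_⟩
    have := Real.exp_pos (K * id t)
    simp only [id, mul_one] at this ⊢
    nlinarith)
  simp only [Pi.mul_apply, mul_zero, Real.exp_zero, one_mul] at h1
  have h2 : Real.exp (-K * T) * Real.exp (K * T) = 1 := by
    rw [← Real.exp_add, ← Real.exp_zero]; ring_nf
  calc F T = Real.exp (-K * T) * (Real.exp (K * T) * F T) := by rw [← mul_assoc, h2, one_mul]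
    _ ≤ _ := mul_le_mul_of_nonneg_left h1 (Real.exp_pos _).le

theorem LipschitzWith.ciSup_of_finite {X ι : Type*} [PseudoMetricSpace X] [Finite ι] [Nonempty ι]
    {K : ℝ≥0} {ρ : ι → X → ℝ} (h : ∀ i, LipschitzWith K (ρ i)) :
    LipschitzWith K fun t => ⨆ i, ρ i t := by
  refine LipschitzWith.of_le_add_mul K fun s t => ciSup_le fun i => ?_
  exact ((h i).le_add_mul s t).trans
    (add_le_add_left (le_ciSup (Set.finite_range fun i => ρ i t).bddAbove i) _)

theorem HasDerivAt.tendsto_backward_slope {F : Type*} [NormedAddCommGroup F] [NormedSpace ℝ F]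
    {u : ℝ → F} {v : F} {t : ℝ} (h : HasDerivAt u v t) :
    Tendsto (fun s : ℝ => (-s)⁻¹ • (u (t - s) - u t)) (𝓝[>] 0) (𝓝 v) := by
  have h1 : Tendsto (fun s : ℝ => -s) (𝓝[>] 0) (𝓝[≠] 0) := by
    refine tendsto_nhdsWithin_iff.2 ⟨?_, ?_⟩
    · exact (Continuous.tendsto' continuous_neg 0 0 neg_zero).mono_left nhdsWithin_le_nhds
    · filter_upwards [self_mem_nhdsWithin] with s hs
      exact neg_ne_zero.2 (ne_of_gt (Set.mem_Ioi.1 hs))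
  simpa [Function.comp_def, sub_eq_add_neg] using (hasDerivAt_iff_tendsto_slope_zero.1 h).comp h1

end Gronwall

theorem exists_weighted_euclidean_equiv {V : Type*} [Fintype V] {d : V → ℝ} (hd : ∀ x, 0 < d x) :
    ∃ Φ : (V → ℝ) ≃L[ℝ] EuclideanSpace ℝ V,
      ∀ f g, inner ℝ (Φ f) (Φ g) = f ⬝ᵥ fun x => g x / d x := by
  let Ψ : (V → ℝ) ≃ₗ[ℝ] EuclideanSpace ℝ V :=
    { toFun := fun f => WithLp.toLp 2 fun x => f x / √(d x)
      map_add' := fun f g => by ext x; simp [add_div]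
      map_smul' := fun c f => by ext x; simp [mul_div_assoc]
      invFun := fun ψ x => ψ x * √(d x)
      left_inv := fun f => by
        ext x
        exact div_mul_cancel₀ _ (Real.sqrt_pos.2 (hd x)).ne'
      right_inv := fun ψ => by
        ext x
        exact mul_div_cancel_right₀ _ (Real.sqrt_pos.2 (hd x)).ne' }
  refine ⟨Ψ.toContinuousLinearEquiv, fun f g => ?_⟩
  rw [PiLp.inner_apply]
  refine Finset.sum_congr rfl fun x _ => ?_
  simp only [Ψ, LinearEquiv.coe_toContinuousLinearEquiv', LinearEquiv.coe_mk, LinearMap.coe_mk,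
    AddHom.coe_mk, RCLike.inner_apply, conj_trivial]
  have h1 := (Real.sqrt_pos.2 (hd x)).ne'
  have h2 := Real.mul_self_sqrt (hd x).le
  calc _ = f x * g x / (√(d x) * √(d x)) := by field_simp
    _ = _ := by rw [h2, mul_div_assoc]

namespace WeightedHypergraph

section Heat

open MeasureTheory Filter
open scoped NNReal RealInnerProductSpace

variable {V : Type*} [Fintype V] [DecidableEq V] (H : WeightedHypergraph V)

/-- The degree, replaced by `1` at the vertices that lie in no hyperedge. -/
noncomputable def posDeg (x : V) : ℝ := if H.deg x = 0 then 1 else H.deg x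

theorem deg_nonneg (x : V) : 0 ≤ H.deg x :=
  Finset.sum_nonneg fun e he => (H.weight_pos e (Finset.mem_filter.1 he).1).le

theorem posDeg_pos (x : V) : 0 < H.posDeg x := by
  unfold posDeg
  split_ifs with h
  · exact one_pos
  · exact (H.deg_nonneg x).lt_of_ne' h

theorem deg_pos_of_mem {e : Finset V} (he : e ∈ H.edges) {x : V} (hx : x ∈ e) : 0 < H.deg x :=
  Finset.sum_pos (fun e he => H.weight_pos e (Finset.mem_filter.1 he).1)
    ⟨e, Finset.mem_filter.2 ⟨he, hx⟩⟩

theorem normLaplacian_eq (f : V → ℝ) :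
    H.normLaplacian f = H.laplacian fun x => f x / H.posDeg x :=
  H.laplacian_congr fun e he x hx => by
    rw [normalize, posDeg, if_neg (H.deg_pos_of_mem he hx).ne']

theorem resolvent_nonempty {lam : ℝ} (hl : 0 < lam) (f : V → ℝ) :
    (H.resolvent lam f).Nonempty := by
  obtain ⟨p, a, ha, he⟩ := H.exists_resolvent_laplacian H.posDeg_pos hl f
  refine ⟨H.posDeg * p, a, ?_, he⟩
  rw [normLaplacian_eq]
  convert ha using 2
  ext x
  exact mul_div_cancel_left₀ _ (H.posDeg_pos x).ne'

theorem smul_mem_normLaplacian {f a : V → ℝ} (ha : a ∈ H.normLaplacian f) {c : ℝ} (hc : 0 ≤ c) :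
    c • a ∈ H.normLaplacian (c • f) := by
  have : H.normalize (c • f) = c • H.normalize f := by
    ext x; simp [normalize, mul_div_assoc]
  rw [normLaplacian, this]
  exact H.smul_mem_laplacian ha hc

theorem zero_mem_normLaplacian_zero : (0 : V → ℝ) ∈ H.normLaplacian 0 := by
  have : H.normalize 0 = 0 := by ext x; simp [normalize]
  rw [normLaplacian, this]
  exact H.zero_mem_laplacian_zero

/-- The normalized Laplacian, transported to `E` by `Φ`. -/
def transport {E : Type*} [NormedAddCommGroup E] [NormedSpace ℝ E] (Φ : (V → ℝ) ≃L[ℝ] E)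
    (ψ : E) : Set E := {a | Φ.symm a ∈ H.normLaplacian (Φ.symm ψ)}

theorem exists_transport_isMonotoneOperator : ∃ Φ : (V → ℝ) ≃L[ℝ] EuclideanSpace ℝ V,
    IsMonotoneOperator (H.transport Φ) := by
  obtain ⟨Φ, hΦ⟩ := exists_weighted_euclidean_equiv H.posDeg_pos
  refine ⟨Φ, fun ψ χ a ha b hb => ?_⟩
  have ha : Φ.symm a ∈ H.normLaplacian (Φ.symm ψ) := ha
  have hb : Φ.symm b ∈ H.normLaplacian (Φ.symm χ) := hb
  rw [normLaplacian_eq] at ha hb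
  have h := H.laplacian_monotone ha hb
  have h1 := hΦ (Φ.symm (a - b)) (Φ.symm (ψ - χ))
  rw [Φ.apply_symm_apply, Φ.apply_symm_apply] at h1
  rw [h1, map_sub]
  convert h using 2
  ext x
  simp [sub_div]

theorem transport_hasResolvents {E : Type*} [NormedAddCommGroup E] [NormedSpace ℝ E]
    (Φ : (V → ℝ) ≃L[ℝ] E) : HasResolvents (H.transport Φ) := fun lam hl f => by
  obtain ⟨g, a, ha, he⟩ := H.resolvent_nonempty hl (Φ.symm f)
  refine ⟨Φ g, Φ a, by simpa [transport] using ha, ?_⟩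
  rw [← map_smul, ← map_add, ← he, Φ.apply_symm_apply]

theorem exists_norm_transport_le {E : Type*} [NormedAddCommGroup E] [NormedSpace ℝ E]
    (Φ : (V → ℝ) ≃L[ℝ] E) : ∃ C : ℝ, 0 ≤ C ∧ ∀ ψ, ∀ a ∈ H.transport Φ ψ, ‖a‖ ≤ C * ‖ψ‖ := by
  set W := ∑ e ∈ H.edges, H.weight e
  set S := ∑ x, 1 / H.posDeg x
  have hW : 0 ≤ W := Finset.sum_nonneg fun e he => (H.weight_pos e he).le
  have hS1 : ∀ x ∈ Finset.univ, 0 ≤ 1 / H.posDeg x :=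
    fun x _ => one_div_nonneg.2 (H.posDeg_pos x).le
  have hS : 0 ≤ S := Finset.sum_nonneg hS1
  refine ⟨‖(Φ : (V → ℝ) →L[ℝ] E)‖ * (W * (2 * (S * ‖(Φ.symm : E →L[ℝ] (V → ℝ))‖))),
    by positivity, fun ψ a ha => ?_⟩
  have ha : Φ.symm a ∈ H.normLaplacian (Φ.symm ψ) := ha
  rw [normLaplacian_eq] at ha
  have h1 : ‖Φ.symm a‖ ≤ _ :=
    (pi_norm_le_iff_of_nonneg (by positivity)).2 fun x => H.abs_laplacian_apply_le ha x
  have h2 : ‖fun x => Φ.symm ψ x / H.posDeg x‖ ≤ S * ‖Φ.symm ψ‖ := by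
    refine (pi_norm_le_iff_of_nonneg (by positivity)).2 fun x => ?_
    rw [norm_div, Real.norm_of_nonneg (H.posDeg_pos x).le, div_eq_mul_one_div, mul_comm]
    exact mul_le_mul (Finset.single_le_sum hS1 (Finset.mem_univ x)) (norm_le_pi_norm _ x)
      (norm_nonneg _) hS
  have h3 : ‖Φ.symm ψ‖ ≤ ‖(Φ.symm : E →L[ℝ] (V → ℝ))‖ * ‖ψ‖ :=
    (Φ.symm : E →L[ℝ] (V → ℝ)).le_opNorm ψ
  calc ‖a‖ = ‖Φ (Φ.symm a)‖ := by rw [Φ.apply_symm_apply]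
    _ ≤ ‖(Φ : (V → ℝ) →L[ℝ] E)‖ * ‖Φ.symm a‖ := (Φ : (V → ℝ) →L[ℝ] E).le_opNorm _
    _ ≤ ‖(Φ : (V → ℝ) →L[ℝ] E)‖ *
        (W * (2 * (S * (‖(Φ.symm : E →L[ℝ] (V → ℝ))‖ * ‖ψ‖)))) := by
      gcongr
      exact h1.trans (by gcongr; exact h2.trans (by gcongr))
    _ = _ := by ring

theorem exists_resolvent_lipschitz : ∃ C : ℝ, 0 ≤ C ∧ ∀ lam : ℝ, 0 < lam →
    ∀ f f' : V → ℝ, ∀ g ∈ H.resolvent lam f, ∀ g' ∈ H.resolvent lam f',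
      ‖g - g'‖ ≤ C * ‖f - f'‖ := by
  obtain ⟨Φ, hΦ⟩ := H.exists_transport_isMonotoneOperator
  set Φ₁ := (Φ : (V → ℝ) →L[ℝ] EuclideanSpace ℝ V)
  set Φ₂ := (Φ.symm : EuclideanSpace ℝ V →L[ℝ] (V → ℝ))
  refine ⟨‖Φ₂‖ * ‖Φ₁‖, by positivity, ?_⟩
  rintro lam hl f f' g ⟨a, ha, he⟩ g' ⟨a', ha', he'⟩
  have h := hΦ.resolvent_nonexpansive hl.le (f := Φ f) (f' := Φ f') (g := Φ g) (g' := Φ g')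
    (a := Φ a) (a' := Φ a') (by simpa [transport] using ha) (by simpa [transport] using ha')
    (by rw [he]; simp) (by rw [he']; simp)
  rw [← map_sub, ← map_sub] at h
  calc ‖g - g'‖ = ‖Φ₂ (Φ (g - g'))‖ := by simp [Φ₂]
    _ ≤ ‖Φ₂‖ * ‖Φ (g - g')‖ := Φ₂.le_opNorm _
    _ ≤ ‖Φ₂‖ * (‖Φ₁‖ * ‖f - f'‖) := by
      gcongr
      exact h.trans (Φ₁.le_opNorm _)
    _ = _ := by ring

theorem exists_lipschitz_heatSolution (f : V → ℝ) :
    ∃ (u : ℝ → V → ℝ) (M : ℝ≥0), H.IsHeatSolution f u ∧ LipschitzWith M u := by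
  obtain ⟨Φ, hΦ⟩ := H.exists_transport_isMonotoneOperator
  obtain ⟨C, hC, hbd⟩ := H.exists_norm_transport_le Φ
  obtain ⟨u, M, hu0, hM, hu⟩ := hΦ.exists_lipschitz_evolution (H.transport_hasResolvents Φ)
    (by simpa [transport] using H.zero_mem_normLaplacian_zero) hC hbd (Φ f)
  have hL := Φ.symm.lipschitz.comp hM
  refine ⟨fun t => Φ.symm (u t), _, ⟨by simp [hu0], fun T _ =>
    (hL.lipschitzOnWith).absolutelyContinuousOnInterval, ?_⟩, hL⟩
  filter_upwards [hu] with t ht hpos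
  obtain ⟨v, hv, hvA⟩ := ht hpos
  refine ⟨Φ.symm v, (Φ.symm : EuclideanSpace ℝ V →L[ℝ] (V → ℝ)).hasFDerivAt.comp_hasDerivAt t hv,
    ?_⟩
  simpa [transport] using hvA

theorem IsHeatSolution.eq {f : V → ℝ} {u v : ℝ → V → ℝ} (hu : H.IsHeatSolution f u)
    (hv : H.IsHeatSolution f v) {t : ℝ} (ht : 0 ≤ t) : u t = v t := by
  obtain ⟨Φ, hΦ⟩ := H.exists_transport_isMonotoneOperator
  rcases ht.eq_or_lt with rfl | ht
  · rw [hu.1, hv.1]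
  refine Φ.injective ?_
  have key : ∀ u : ℝ → V → ℝ, H.IsHeatSolution f u →
      ∀ᵐ t : ℝ, 0 < t → ∃ w, HasDerivAt (fun t => Φ (u t)) w t ∧ -w ∈ H.transport Φ (Φ (u t)) :=
    fun u hu => by
      filter_upwards [hu.2.2] with t ht hpos
      obtain ⟨w, hw, hwA⟩ := ht hpos
      refine ⟨Φ w, (Φ : (V → ℝ) →L[ℝ] EuclideanSpace ℝ V).hasFDerivAt.comp_hasDerivAt t hw, ?_⟩
      simpa [transport] using hwA
  exact hΦ.eq_of_ae_hasDerivAt (u := fun t => Φ (u t)) (v := fun t => Φ (v t)) ht.le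
    (by rw [hu.1, hv.1])
    (Φ.lipschitz.comp_absolutelyContinuousOnInterval (hu.2.1 t ht))
    (Φ.lipschitz.comp_absolutelyContinuousOnInterval (hv.2.1 t ht)) (key u hu) (key v hv)

theorem isHeatSolution_heat (f : V → ℝ) : H.IsHeatSolution f fun t => H.heat t f := by
  obtain ⟨u, -, hu, -⟩ := H.exists_lipschitz_heatSolution f
  exact Classical.epsilon_spec (p := H.IsHeatSolution f) ⟨u, hu⟩

end Heat

end WeightedHypergraph

namespace WeightedHypergraph

section Distance

variable {V : Type*} [Fintype V] (H : WeightedHypergraph V)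

theorem dist_self (x : V) : H.dist x x = 0 :=
  Nat.sInf_eq_zero.2 (Or.inl ⟨fun _ => x, rfl, rfl, by simp⟩)

theorem HasPath.symm {x y : V} {n : ℕ} (h : H.HasPath x y n) : H.HasPath y x n := by
  obtain ⟨z, h0, hn, hz⟩ := h
  refine ⟨fun i => z (n - i), by simpa using hn, by simpa using h0, fun i hi => ?_⟩
  obtain ⟨e, he, h1, h2⟩ := hz (n - (i + 1)) (by omega)
  rw [show n - (i + 1) + 1 = n - i by omega] at h2
  exact ⟨e, he, h2, h1⟩

theorem dist_comm (x y : V) : H.dist x y = H.dist y x := by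
  unfold dist
  congr 1
  ext n
  exact ⟨fun h => HasPath.symm H h, fun h => HasPath.symm H h⟩

variable {H}

theorem Connected.dist_pos (hconn : H.Connected) {x y : V} (hxy : x ≠ y) : 0 < H.dist x y := by
  have h : H.HasPath x y (H.dist x y) := Nat.sInf_mem (hconn x y)
  refine Nat.pos_of_ne_zero fun h0 => hxy ?_
  rw [h0] at h
  obtain ⟨z, h1, h2, -⟩ := h
  rw [← h1, h2]

end Distance

section Gradient

open MeasureTheory Filter
open scoped NNReal

variable {V : Type*} [Fintype V] [DecidableEq V] {H : WeightedHypergraph V}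

theorem WeightedLipschitz.smul {K c : ℝ} {f : V → ℝ} (hf : H.WeightedLipschitz K f)
    (hc : 0 ≤ c) : H.WeightedLipschitz (c * K) (c • f) := fun x y => by
  have : (c • f) x / H.deg x - (c • f) y / H.deg y = c * (f x / H.deg x - f y / H.deg y) := by
    simp only [Pi.smul_apply, smul_eq_mul]; ring
  rw [this, abs_mul, abs_of_nonneg hc, mul_assoc]
  exact mul_le_mul_of_nonneg_left (hf x y) hc

theorem WeightedLipschitz.mono {K K' : ℝ} {f : V → ℝ} (hf : H.WeightedLipschitz K f)
    (h : K ≤ K') : H.WeightedLipschitz K' f := fun x y =>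
  (hf x y).trans (mul_le_mul_of_nonneg_right h (Nat.cast_nonneg _))

theorem smul_mem_resolvent {lam c : ℝ} (hc : 0 ≤ c) {f g : V → ℝ} (hg : g ∈ H.resolvent lam f) :
    c • g ∈ H.resolvent lam (c • f) := by
  obtain ⟨a, ha, rfl⟩ := hg
  exact ⟨c • a, H.smul_mem_normLaplacian ha hc, by rw [smul_add, smul_comm]⟩

variable (H) in
/-- The energy estimate: the resolvent moves `1`-Lipschitz functions by `O(lam)`. -/
theorem exists_abs_sub_resolvent_le : ∃ C : ℝ, ∀ lam : ℝ, 0 < lam → ∀ f : V → ℝ,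
    H.WeightedLipschitz 1 f → ∀ g ∈ H.resolvent lam f, ∀ z, |f z - g z| ≤ lam * C := by
  set R : ℝ := ∑ p : V × V, (H.dist p.1 p.2 : ℝ)
  set W := ∑ e ∈ H.edges, H.weight e
  refine ⟨(R ^ 2 * W + W) / 2, ?_⟩
  rintro lam hl f hf _ ⟨_, ⟨b, hb, rfl⟩, he⟩ z
  rename_i g
  set p := H.normalize g
  set a := ∑ e ∈ H.edges, (H.weight e * (b e ⬝ᵥ p)) • b e with ha
  have hm0 : ∀ e ∈ H.edges, 0 ≤ b e ⬝ᵥ p := fun e he => by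
    simpa using (hb e he).2 0 (zero_mem_basePolytope (H.edges_nonempty e he))
  have hw : ∀ e ∈ H.edges, 0 ≤ H.weight e := fun e he => (H.weight_pos e he).le
  have hfR : ∀ e ∈ H.edges, b e ⬝ᵥ H.normalize f ≤ R := fun e he =>
    dotProduct_le_of_mem_basePolytope (fun x _ y _ => by
      have h1 := (le_abs_self _).trans (hf x y)
      have h2 := Finset.single_le_sum (f := fun p : V × V => (H.dist p.1 p.2 : ℝ))
        (fun p _ => Nat.cast_nonneg _) (Finset.mem_univ (x, y))
      simp only [one_mul] at h1
      exact h1.trans h2) (hb e he).1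
  have hdot : ∀ r, a ⬝ᵥ r = ∑ e ∈ H.edges, H.weight e * (b e ⬝ᵥ p) * (b e ⬝ᵥ r) := fun r => by
    rw [ha, sum_dotProduct]
    simp [smul_dotProduct]
  have hEn : a ⬝ᵥ p ≤ a ⬝ᵥ H.normalize f := by
    have h1 : H.normalize f = p + lam • H.normalize a := by
      ext x
      simp only [p, normalize, Pi.add_apply, Pi.smul_apply, smul_eq_mul]
      rw [he]
      simp only [Pi.add_apply, Pi.smul_apply, smul_eq_mul]
      ring
    have h2 : 0 ≤ a ⬝ᵥ H.normalize a := Finset.sum_nonneg fun x _ => by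
      rw [normalize, ← mul_div_assoc]
      exact div_nonneg (mul_self_nonneg _) (H.deg_nonneg x)
    rw [h1, dotProduct_add, dotProduct_smul, smul_eq_mul]
    linarith [mul_nonneg hl.le h2]
  have hsq : ∑ e ∈ H.edges, H.weight e * (b e ⬝ᵥ p) ^ 2 ≤ R ^ 2 * W := by
    have h1 : a ⬝ᵥ p = ∑ e ∈ H.edges, H.weight e * (b e ⬝ᵥ p) ^ 2 := by
      rw [hdot]; exact Finset.sum_congr rfl fun e _ => by ring
    have h2 : a ⬝ᵥ H.normalize f ≤
        ∑ e ∈ H.edges, (H.weight e * (b e ⬝ᵥ p) ^ 2 / 2 + R ^ 2 * H.weight e / 2) := by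
      rw [hdot]
      refine Finset.sum_le_sum fun e he => ?_
      have := mul_le_mul_of_nonneg_left (hfR e he) (mul_nonneg (hw e he) (hm0 e he))
      nlinarith [mul_nonneg (hw e he) (sq_nonneg (b e ⬝ᵥ p - R))]
    rw [Finset.sum_add_distrib, ← Finset.sum_div, ← Finset.sum_div, ← Finset.mul_sum] at h2
    linarith
  have haz : |a z| ≤ (R ^ 2 * W + W) / 2 := by
    have h1 : |a z| ≤ ∑ e ∈ H.edges, (H.weight e * (b e ⬝ᵥ p) ^ 2 / 2 + H.weight e / 2) := by
      rw [ha, Finset.sum_apply]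
      refine (Finset.abs_sum_le_sum_abs _ _).trans (Finset.sum_le_sum fun e he => ?_)
      have h3 := mul_nonneg (hw e he) (hm0 e he)
      rw [Pi.smul_apply, smul_eq_mul, abs_mul, abs_of_nonneg h3]
      have := mul_le_mul_of_nonneg_left (abs_apply_le_one_of_mem_basePolytope (hb e he).1 z) h3
      nlinarith [mul_nonneg (hw e he) (sq_nonneg (b e ⬝ᵥ p - 1))]
    rw [Finset.sum_add_distrib, ← Finset.sum_div, ← Finset.sum_div] at h1
    linarith
  rw [he]
  simp only [Pi.add_apply, Pi.smul_apply, smul_eq_mul, add_sub_cancel_left]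
  rw [abs_mul, abs_of_pos hl]
  exact mul_le_mul_of_nonneg_left haz hl.le

variable (H) in
theorem exists_resolvent_difference_le (x y : V) : ∃ C : ℝ, ∀ lam : ℝ, 0 < lam → ∀ f : V → ℝ,
    H.WeightedLipschitz 1 f → ∀ g ∈ H.resolvent lam f,
      g x / H.deg x - g y / H.deg y ≤ H.dist x y + lam * C := by
  obtain ⟨C, hC⟩ := H.exists_abs_sub_resolvent_le
  refine ⟨C / H.deg x + C / H.deg y, fun lam hl f hf g hg => ?_⟩
  have h1 := (le_abs_self _).trans (hf x y)
  have h2 : g x / H.deg x ≤ (f x + lam * C) / H.deg x :=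
    div_le_div_of_nonneg_right (by linarith [(abs_le.1 (hC lam hl f hf g hg x)).1]) (H.deg_nonneg x)
  have h3 : (f y - lam * C) / H.deg y ≤ g y / H.deg y :=
    div_le_div_of_nonneg_right (by linarith [(abs_le.1 (hC lam hl f hf g hg y)).2]) (H.deg_nonneg y)
  rw [add_div] at h2
  rw [sub_div] at h3
  have h4 : lam * (C / H.deg x + C / H.deg y) = lam * C / H.deg x + lam * C / H.deg y := by ring
  rw [h4]
  linarith

variable (H) in
theorem exists_kantorovichDiff_le (x y : V) : ∃ C : ℝ, ∀ lam : ℝ, 0 < lam →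
    H.kantorovichDiff lam x y ≤ H.dist x y + lam * C := by
  obtain ⟨C, hC⟩ := H.exists_resolvent_difference_le x y
  refine ⟨C, fun lam hl => csSup_le ?_ ?_⟩
  · obtain ⟨g, hg⟩ := H.resolvent_nonempty hl 0
    exact ⟨_, 0, fun x y => by simp, g, hg, rfl⟩
  · rintro _ ⟨f, hf, g, hg, rfl⟩
    exact hC lam hl f hf g hg

theorem WeightedLipschitz.resolvent_difference_le {K : ℝ} (hK : 0 ≤ K) {f g : V → ℝ}
    (hf : H.WeightedLipschitz K f) {lam : ℝ} (hl : 0 < lam) (hg : g ∈ H.resolvent lam f)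
    (x y : V) : g x / H.deg x - g y / H.deg y ≤ K * H.kantorovichDiff lam x y := by
  have hpos : ∀ K : ℝ, 0 < K → H.WeightedLipschitz K f →
      g x / H.deg x - g y / H.deg y ≤ K * H.kantorovichDiff lam x y := fun K hK hf => by
    obtain ⟨C, hC⟩ := H.exists_resolvent_difference_le x y
    have h1 : K⁻¹ * (g x / H.deg x - g y / H.deg y) ≤ H.kantorovichDiff lam x y := by
      refine le_csSup ⟨H.dist x y + lam * C, ?_⟩
        ⟨K⁻¹ • f, ?_, K⁻¹ • g, smul_mem_resolvent (inv_pos.2 hK).le hg, ?_⟩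
      · rintro _ ⟨f, hf, g, hg, rfl⟩
        exact hC lam hl f hf g hg
      · simpa [inv_mul_cancel₀ hK.ne'] using hf.smul (inv_pos.2 hK).le
      · simp only [Pi.smul_apply, smul_eq_mul]; ring
    rwa [inv_mul_le_iff₀ hK] at h1
  have hlim : Tendsto (fun K' => K' * H.kantorovichDiff lam x y) (𝓝[>] K)
      (𝓝 (K * H.kantorovichDiff lam x y)) :=
    (Continuous.tendsto (by fun_prop) K).mono_left nhdsWithin_le_nhds
  refine ge_of_tendsto hlim ?_
  filter_upwards [self_mem_nhdsWithin] with K' hK'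
  exact hpos K' (hK.trans_lt hK') (hf.mono (le_of_lt hK'))

theorem Connected.isCoboundedUnder_lamCurvature (hconn : H.Connected) {x y : V} (hxy : x ≠ y) :
    (𝓝[>] (0 : ℝ)).IsCoboundedUnder (· ≤ ·) fun lam => H.lamCurvature lam x y / lam := by
  obtain ⟨C, hC⟩ := H.exists_kantorovichDiff_le x y
  refine isCoboundedUnder_le_of_eventually_le (x := -(C / H.dist x y)) _ ?_
  filter_upwards [self_mem_nhdsWithin] with lam hl
  have hl : 0 < lam := hl
  have hd : (0 : ℝ) < H.dist x y := Nat.cast_pos.2 (hconn.dist_pos hxy)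
  rw [le_div_iff₀ hl, lamCurvature]
  have h1 := div_le_div_of_nonneg_right (hC lam hl) hd.le
  rw [add_div, div_self hd.ne'] at h1
  have h2 : -(C / H.dist x y) * lam = -(lam * C / H.dist x y) := by ring
  rw [h2]
  linarith

/-- The functional `f ↦ (f x / d_x - f y / d_y) / d(x, y)`. -/
noncomputable def slopeFunctional (H : WeightedHypergraph V) (p : {p : V × V // p.1 ≠ p.2}) :
    (V → ℝ) →L[ℝ] ℝ :=
  (H.dist p.1.1 p.1.2 : ℝ)⁻¹ • ((H.deg p.1.1)⁻¹ • ContinuousLinearMap.proj p.1.1 -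
    (H.deg p.1.2)⁻¹ • ContinuousLinearMap.proj p.1.2)

theorem slopeFunctional_apply (p : {p : V × V // p.1 ≠ p.2}) (f : V → ℝ) :
    H.slopeFunctional p f =
      (f p.1.1 / H.deg p.1.1 - f p.1.2 / H.deg p.1.2) / H.dist p.1.1 p.1.2 := by
  simp [slopeFunctional, div_eq_inv_mul]

/-- The least weighted Lipschitz constant of `f`. -/
noncomputable def lipConst (H : WeightedHypergraph V) (f : V → ℝ) : ℝ :=
  ⨆ p : {p : V × V // p.1 ≠ p.2}, H.slopeFunctional p f

theorem slopeFunctional_le_lipConst (p : {p : V × V // p.1 ≠ p.2}) (f : V → ℝ) :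
    H.slopeFunctional p f ≤ H.lipConst f :=
  le_ciSup (Set.finite_range fun p => H.slopeFunctional p f).bddAbove p

theorem Connected.sub_le_lipConst_mul (hconn : H.Connected) (f : V → ℝ) (x y : V) :
    f x / H.deg x - f y / H.deg y ≤ H.lipConst f * H.dist x y := by
  rcases eq_or_ne x y with rfl | hxy
  · simp [dist_self]
  · have := slopeFunctional_le_lipConst (H := H) ⟨(x, y), hxy⟩ f
    rwa [slopeFunctional_apply, div_le_iff₀ (Nat.cast_pos.2 (hconn.dist_pos hxy))] at this

theorem Connected.weightedLipschitz_lipConst (hconn : H.Connected) (f : V → ℝ) :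
    H.WeightedLipschitz (H.lipConst f) f := fun x y =>
  abs_sub_le_iff.2 ⟨hconn.sub_le_lipConst_mul f x y, by
    rw [dist_comm]; exact hconn.sub_le_lipConst_mul f y x⟩

theorem Connected.lipConst_nonneg (hconn : H.Connected) (f : V → ℝ) : 0 ≤ H.lipConst f := by
  rcases isEmpty_or_nonempty {p : V × V // p.1 ≠ p.2} with h | ⟨⟨⟨x, y⟩, hxy⟩⟩
  · simp [lipConst]
  · have h := (abs_nonneg _).trans (hconn.weightedLipschitz_lipConst f x y)
    exact nonneg_of_mul_nonneg_left h (Nat.cast_pos.2 (hconn.dist_pos hxy))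

theorem Connected.lipConst_le_one (hconn : H.Connected) {f : V → ℝ}
    (hf : H.WeightedLipschitz 1 f) : H.lipConst f ≤ 1 := by
  refine Real.iSup_le (fun p => ?_) zero_le_one
  rw [slopeFunctional_apply, div_le_iff₀ (Nat.cast_pos.2 (hconn.dist_pos p.2))]
  exact (le_abs_self _).trans (hf _ _)

theorem exists_lipschitzWith_lipConst (H : WeightedHypergraph V) [Nontrivial V] :
    ∃ K : ℝ≥0, LipschitzWith K H.lipConst := by
  have : Nonempty {p : V × V // p.1 ≠ p.2} := by
    obtain ⟨x, y, h⟩ := exists_pair_ne V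
    exact ⟨⟨(x, y), h⟩⟩
  refine ⟨∑ p, ‖H.slopeFunctional p‖₊, LipschitzWith.ciSup_of_finite fun p => ?_⟩
  exact (H.slopeFunctional p).lipschitz.weaken
    (Finset.single_le_sum (f := fun p => ‖H.slopeFunctional p‖₊) (fun _ _ => zero_le)
      (Finset.mem_univ p))

/-- The differential inequality for the Lipschitz constant along the heat flow. -/
theorem Connected.deriv_lipConst_le (hconn : H.Connected) [Nontrivial V] {K : ℝ}
    (hK : K < H.infUpperCurvature) {u : ℝ → V → ℝ} {t : ℝ} {v : V → ℝ} (hu : HasDerivAt u v t)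
    (hv : -v ∈ H.normLaplacian (u t)) {L : ℝ} (hL : HasDerivAt (fun s => H.lipConst (u s)) L t) :
    L ≤ -K * H.lipConst (u t) := by
  have : Nonempty {p : V × V // p.1 ≠ p.2} := by
    obtain ⟨x, y, h⟩ := exists_pair_ne V
    exact ⟨⟨(x, y), h⟩⟩
  obtain ⟨p, hp⟩ := exists_eq_ciSup_of_finite (f := fun p => H.slopeFunctional p (u t))
  have hp : H.slopeFunctional p (u t) = H.lipConst (u t) := hp
  obtain ⟨⟨x, y⟩, hxy⟩ := p
  set φ := H.slopeFunctional ⟨(x, y), hxy⟩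
  have hd : (0 : ℝ) < H.dist x y := Nat.cast_pos.2 (hconn.dist_pos hxy)
  have hcurv : K < H.upperCurvature x y := hK.trans_le
    (ciInf_le (Set.finite_range fun p : {p : V × V // p.1 ≠ p.2} =>
      H.upperCurvature p.1.1 p.1.2).bddBelow ⟨(x, y), hxy⟩)
  have hfreq := (frequently_lt_of_lt_limsup (hconn.isCoboundedUnder_lamCurvature hxy) hcurv)
  obtain ⟨C, hC0, hC⟩ := H.exists_resolvent_lipschitz
  have hslope := hL.tendsto_backward_slope
  have hcontL : Tendsto (fun s : ℝ => H.lipConst (u (t - s))) (𝓝[>] 0) (𝓝 (H.lipConst (u t))) := by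
    have h1 : Tendsto (fun s : ℝ => t - s) (𝓝 0) (𝓝 t) :=
      Continuous.tendsto' (by fun_prop) 0 t (by simp)
    exact (hL.continuousAt.tendsto.comp h1).mono_left nhdsWithin_le_nhds
  have hrem : Tendsto (fun s : ℝ => ‖v - (-s)⁻¹ • (u (t - s) - u t)‖) (𝓝[>] 0) (𝓝 0) := by
    simpa using (hu.tendsto_backward_slope.const_sub v).norm
  have hrhs := (hcontL.const_mul (-K)).add (hrem.const_mul (‖φ‖ * C))
  rw [mul_zero, add_zero] at hrhs
  refine le_of_tendsto_of_tendsto_of_frequently hslope hrhs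
    ((hfreq.and_eventually self_mem_nhdsWithin).mono ?_)
  rintro s ⟨hs, hs0⟩
  have hs0 : 0 < s := hs0
  rw [lt_div_iff₀ hs0, lamCurvature] at hs
  obtain ⟨g, hg⟩ := H.resolvent_nonempty hs0 (u (t - s))
  have h1 : ‖u t - g‖ ≤ C * (s * ‖v - (-s)⁻¹ • (u (t - s) - u t)‖) := by
    refine (hC s hs0 (u t + s • -v) _ (u t) ⟨-v, hv, rfl⟩ g hg).trans (le_of_eq ?_)
    congr 1
    rw [← norm_neg (v - _), ← Real.norm_of_nonneg hs0.le, ← norm_smul, Real.norm_of_nonneg hs0.le]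
    congr 1
    rw [neg_sub, smul_sub, smul_smul, inv_neg, mul_neg, mul_inv_cancel₀ hs0.ne', smul_neg]
    module
  have h2 : φ g ≤ H.lipConst (u (t - s)) * (1 - K * s) := by
    have h3 := (hconn.weightedLipschitz_lipConst (u (t - s))).resolvent_difference_le
      (hconn.lipConst_nonneg _) hs0 hg x y
    have h4 : φ g = (g x / H.deg x - g y / H.deg y) / H.dist x y := slopeFunctional_apply _ _
    rw [h4, div_le_iff₀ hd, mul_assoc]
    refine h3.trans (mul_le_mul_of_nonneg_left ?_ (hconn.lipConst_nonneg _))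
    rw [← div_le_iff₀ hd]
    linarith
  have h5 : φ (u t) - φ g ≤ ‖φ‖ * ‖u t - g‖ := by
    rw [← map_sub]
    exact (le_abs_self _).trans (φ.le_opNorm _)
  have h6 := mul_le_mul_of_nonneg_left h1 (norm_nonneg φ)
  have h7 : (-s)⁻¹ • (H.lipConst (u (t - s)) - H.lipConst (u t)) =
      (H.lipConst (u t) - H.lipConst (u (t - s))) / s := by
    rw [smul_eq_mul, inv_neg]; ring
  rw [h7, div_le_iff₀ hs0, ← hp]
  nlinarith

theorem Connected.lipConst_heatSolution_le (hconn : H.Connected) [Nontrivial V] {f : V → ℝ}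
    {u : ℝ → V → ℝ} {M : ℝ≥0} (hu : H.IsHeatSolution f u) (hM : LipschitzWith M u) {T : ℝ}
    (hT : 0 ≤ T) :
    H.lipConst (u T) ≤ Real.exp (-H.infUpperCurvature * T) * H.lipConst f := by
  obtain ⟨C, hC⟩ := H.exists_lipschitzWith_lipConst
  have hLip : LipschitzWith (C * M) fun s => H.lipConst (u s) := hC.comp hM
  have hlim : Tendsto (fun K : ℝ => Real.exp (-K * T) * H.lipConst f)
      (𝓝[<] H.infUpperCurvature) (𝓝 (Real.exp (-H.infUpperCurvature * T) * H.lipConst f)) :=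
    (Continuous.tendsto (by fun_prop) _).mono_left nhdsWithin_le_nhds
  refine ge_of_tendsto hlim ?_
  filter_upwards [self_mem_nhdsWithin] with K hK
  rw [← hu.1]
  refine hLip.lipschitzOnWith.absolutelyContinuousOnInterval.le_exp_mul_of_ae_deriv_le hT ?_
  filter_upwards [hLip.ae_differentiableAt_real, hu.2.2] with t ht1 ht2 hpos
  obtain ⟨v, hv, hvA⟩ := ht2 hpos
  exact ⟨_, ht1.hasDerivAt, hconn.deriv_lipConst_le hK hv hvA ht1.hasDerivAt⟩

theorem Connected.heat_gradient_estimate (hconn : H.Connected) {f : V → ℝ}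
    (hf : H.WeightedLipschitz 1 f) (x y : V) {t : ℝ} (ht : 0 < t) :
    H.heat t f x / H.deg x - H.heat t f y / H.deg y ≤
      Real.exp (-H.infUpperCurvature * t) * H.dist x y := by
  rcases eq_or_ne x y with rfl | hxy
  · simp [dist_self]
  have : Nontrivial V := ⟨x, y, hxy⟩
  obtain ⟨u, M, hu, hM⟩ := H.exists_lipschitz_heatSolution f
  have heq : H.heat t f = u t := (H.isHeatSolution_heat f).eq H hu ht.le
  rw [heq]
  refine (hconn.sub_le_lipConst_mul (u t) x y).trans ?_
  refine mul_le_mul_of_nonneg_right ?_ (Nat.cast_nonneg _)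
  refine (hconn.lipConst_heatSolution_le hu hM ht.le).trans ?_
  exact mul_le_of_le_one_right (Real.exp_pos _).le (hconn.lipConst_le_one hf)

end Gradient

end WeightedHypergraph

theorem mainTheorem3 {V : Type*} [Fintype V] [DecidableEq V] (H : WeightedHypergraph V)
    (hconn : H.Connected) :
    -- the heat semigroup is well defined: strong solutions exist and are unique
    (∀ f : V → ℝ, H.IsHeatSolution f (fun t => H.heat t f)) ∧
    (∀ (f : V → ℝ) (u : ℝ → V → ℝ), H.IsHeatSolution f u → ∀ t : ℝ, 0 ≤ t → u t = H.heat t f) ∧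
    -- the gradient estimate
    ∀ f : V → ℝ, H.WeightedLipschitz 1 f → ∀ (x y : V) (t : ℝ), 0 < t →
      H.heat t f x / H.deg x - H.heat t f y / H.deg y ≤
        Real.exp (-H.infUpperCurvature * t) * H.dist x y :=
  ⟨H.isHeatSolution_heat, fun f _ hu _ ht => hu.eq H (H.isHeatSolution_heat f) ht,
    fun _ hf x y _ ht => hconn.heat_gradient_estimate hf x y ht⟩
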